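/- Let $n\ge 2$. For $t\ge 0$ let $\Omega_n(t)$ be the average of $\xi\mapsto e^{i u\cdot \xi}$ over the unit sphere $S^{n-1}\subseteq\mathbb R^n$ with respect to surface measure, for any $u\in\mathbb R^n$ with $\|u\|=t$. Write $B(x,\delta)$ for the open ball of radius $\delta$ centred at $x$. For a finite nonempty set $U\subseteq\mathbb R^n$ let $\mathcal C^*(U)$ be the cone of copositive matrices, that is, of symmetric $Z\in\mathbb R^{U\times U}$ with $\sum_{x,y\in U}Z(x,y)f(x)f(y)\ge 0$ for all $f\colon U\to[0,\infty)$, and let $\mathcal T^*(U)=\{Z\in\mathcal C^*(U): \sum_{x,y\in U}|Z(x,y)|\le 1\}$. For each such $U$ fix a countable dense subset $\mathcal T^*_{\aleph_0}(U)$ of $\mathcal T^*(U)$ all of whose members $Z$ satisfy $\operatorname{tr}Z>0$ and $\sum_{x,y\in U}Z(x,y)>0$. Consider the countable set of all functions $r\colon[0,\infty)\to\mathbb R$ of the form $$r(t)=\sum_{x,y\in U}Z(x,y)\int_{B(x,\delta)}\int_{B(y,\delta)}\Omega_n(t\|x'-y'\|)\,dy'\,dx',$$ where $U\subseteq\mathbb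 Q^n$ is finite with at least two points, $Z\in\mathcal T^*_{\aleph_0}(U)$, and $\delta=m(U)/(2k)$ for an integer $k\ge 1$, with $m(U)=\min\{\|x-y\|:x,y\in U,\ x\ne y\}$. Let $r_1,r_2,\dots$ be any enumeration of this set (repetitions allowed). For an integer $N\ge 0$ let $\vartheta_N$ be the supremum of $\alpha(\{0\})$ over all Borel measures $\alpha$ on $[0,\infty)$ such that $\alpha([0,\infty))=1$, $\int_0^\infty\Omega_n(t)\,d\alpha(t)=0$, and $\int_0^\infty r_k(t)\,d\alpha(t)\ge 0$ for $1\le k\le N$. Then $\vartheta_N$ is finite (the feasible set is nonempty and the objective is bounded), and there is no duality gap: the infimum of $\lambda$ over all $\lambda,z\in\mathbb R$ and $y\in\mathbb R^N$ such that $$\lambda+z+\sum_{k=1}^N y_kr_k(0)\ge 1,\qquad \lambda+z\,\Omega_n(t)+\sum_{k=1}^N y_kr_k(t)\ge 0\ \text{ for all } t>0,\qquad y_k\le 0\ \text{ for } k=1,\dots,N,$$ equals $\vartheta_N$. -/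

import Mathlib

open scoped NNReal

noncomputable section

/-- The vector `t e₁` of `ℝⁿ`. -/
def axisVec (n : ℕ) (t : ℝ) : EuclideanSpace ℝ (Fin n) :=
  WithLp.toLp 2 (fun i => if (i : ℕ) = 0 then t else 0)

/-- The average of `ξ ↦ e^{i u · ξ}` over the unit sphere `S^{n-1}`, with respect to the
surface measure. -/
def sphereAvg (n : ℕ) (u : EuclideanSpace ℝ (Fin n)) : ℂ :=
  ⨍ ξ : Metric.sphere (0 : EuclideanSpace ℝ (Fin n)) 1,
    Complex.exp (Complex.I * ((inner ℝ u (ξ : EuclideanSpace ℝ (Fin n)) : ℝ) : ℂ))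
    ∂(MeasureTheory.volume : MeasureTheory.Measure (EuclideanSpace ℝ (Fin n))).toSphere

/-- The function `Ω_n`: for `n ≥ 1` it is the real-valued function such that `Ω_n(‖u‖)` is the
average of `ξ ↦ e^{i u · ξ}` over `S^{n-1}`, for all `u ∈ ℝⁿ`; see `Omega_norm`. -/
def Omega (n : ℕ) (t : ℝ) : ℝ := (sphereAvg n (axisVec n t)).re

/-- The action of a linear isometry on the unit sphere. -/
def sphereMap {n : ℕ} (L : EuclideanSpace ℝ (Fin n) ≃ₗᵢ[ℝ] EuclideanSpace ℝ (Fin n)) :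
    Metric.sphere (0 : EuclideanSpace ℝ (Fin n)) 1 ≃ₜ
      Metric.sphere (0 : EuclideanSpace ℝ (Fin n)) 1 :=
  L.toHomeomorph.subtype (fun x => by simp)

theorem measurePreserving_sphereMap {n : ℕ}
    (L : EuclideanSpace ℝ (Fin n) ≃ₗᵢ[ℝ] EuclideanSpace ℝ (Fin n)) :
    MeasureTheory.MeasurePreserving (sphereMap L)
      (MeasureTheory.volume : MeasureTheory.Measure (EuclideanSpace ℝ (Fin n))).toSphere
      (MeasureTheory.volume : MeasureTheory.Measure (EuclideanSpace ℝ (Fin n))).toSphere := by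
  refine ⟨(sphereMap L).measurable, ?_⟩
  ext s hs
  rw [MeasureTheory.Measure.map_apply (sphereMap L).measurable hs,
    MeasureTheory.Measure.toSphere_apply' _ ((sphereMap L).measurable hs),
    MeasureTheory.Measure.toSphere_apply' _ hs]
  congr 1
  rw [← L.symm.measurePreserving.measure_preimage_equiv
    (f := L.symm.toHomeomorph.toMeasurableEquiv)]
  congr 1
  ext x
  simp only [Set.mem_smul, Set.mem_image, Set.mem_preimage]
  constructor
  · rintro ⟨c, hc, y, ⟨ξ, hξ, rfl⟩, h⟩
    refine ⟨c, hc, _, ⟨_, hξ, rfl⟩, ?_⟩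
    have h' : c • (ξ : EuclideanSpace ℝ (Fin n)) = L.symm x := h
    rw [← L.apply_symm_apply x, ← h', L.map_smul]
    rfl
  · rintro ⟨c, hc, y, ⟨ξ, hξ, rfl⟩, rfl⟩
    refine ⟨c, hc, _, ⟨(sphereMap L).symm ξ, by simpa using hξ, rfl⟩, ?_⟩
    exact (L.symm.map_smul c _).symm

theorem sphereAvg_map {n : ℕ} (L : EuclideanSpace ℝ (Fin n) ≃ₗᵢ[ℝ] EuclideanSpace ℝ (Fin n))
    (u : EuclideanSpace ℝ (Fin n)) : sphereAvg n (L u) = sphereAvg n u := by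
  unfold sphereAvg
  rw [MeasureTheory.average_eq, MeasureTheory.average_eq,
    ← (measurePreserving_sphereMap L).integral_comp (sphereMap L).measurableEmbedding]
  congr 2
  ext ξ
  have : ((sphereMap L ξ : Metric.sphere (0 : EuclideanSpace ℝ (Fin n)) 1) :
    EuclideanSpace ℝ (Fin n)) = L ξ := rfl
  rw [this, L.inner_map_map]

theorem sphereAvg_congr_norm {n : ℕ} {u v : EuclideanSpace ℝ (Fin n)} (h : ‖u‖ = ‖v‖) :
    sphereAvg n u = sphereAvg n v := by
  rw [← Submodule.reflection_sub h, sphereAvg_map]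

/-- The defining property of `Ω_n`. -/
theorem Omega_norm {n : ℕ} (hn : 1 ≤ n) (u : EuclideanSpace ℝ (Fin n)) :
    ((Omega n ‖u‖ : ℝ) : ℂ) = sphereAvg n u := by
  have hax : ‖axisVec n ‖u‖‖ = ‖u‖ := by
    have : axisVec n ‖u‖ = EuclideanSpace.single (⟨0, hn⟩ : Fin n) ‖u‖ := by
      ext i
      simp [axisVec, Fin.ext_iff]
    rw [this]
    simp
  have hreal : ((sphereAvg n u).re : ℂ) = sphereAvg n u := by
    rw [← Complex.conj_eq_iff_re]
    have h := sphereAvg_congr_norm (norm_neg u)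
    refine Eq.trans ?_ h
    unfold sphereAvg
    rw [MeasureTheory.average_eq, MeasureTheory.average_eq, Complex.real_smul,
      Complex.real_smul, map_mul, ← integral_conj, Complex.conj_ofReal]
    congr 2
    ext ξ
    rw [← Complex.exp_conj]
    simp
  rw [Omega, sphereAvg_congr_norm hax, hreal]

/-- `C*(U)`: the symmetric matrices `Z`, indexed by the finite set `U`, with
`∑_{x,y} Z(x,y) f(x) f(y) ≥ 0` for all `f ≥ 0`. -/
def copositiveCone {n : ℕ} (U : Finset (EuclideanSpace ℝ (Fin n))) : Set (Matrix U U ℝ) :=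
  {Z | Z.IsSymm ∧ ∀ f : U → ℝ, (∀ x, 0 ≤ f x) → 0 ≤ ∑ x, ∑ y, Z x y * f x * f y}

/-- The tip of `C*(U)`: its elements of entrywise `L¹` norm at most `1`. -/
def tip {n : ℕ} (U : Finset (EuclideanSpace ℝ (Fin n))) : Set (Matrix U U ℝ) :=
  {Z | Z ∈ copositiveCone U ∧ ∑ x, ∑ y, |Z x y| ≤ 1}

/-- `T` chooses, for each finite nonempty `U ⊆ ℝⁿ`, a countable dense subset of the tip of
`C*(U)` whose members have positive trace and positive sum of entries. -/
def IsTipSelection {n : ℕ}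
    (T : (U : Finset (EuclideanSpace ℝ (Fin n))) → Set (Matrix U U ℝ)) : Prop :=
  ∀ U : Finset (EuclideanSpace ℝ (Fin n)), U.Nonempty →
    (T U).Countable ∧ T U ⊆ tip U ∧ tip U ⊆ closure (T U) ∧
    ∀ Z ∈ T U, 0 < Z.trace ∧ 0 < ∑ x, ∑ y, Z x y

/-- The function
`r(t) = ∑_{x,y ∈ U} Z(x,y) ∫_{B(x,δ)} ∫_{B(y,δ)} Ω_n(t ‖x' - y'‖) dy' dx'` on `[0, ∞)`. -/
def thickFun {n : ℕ} (U : Finset (EuclideanSpace ℝ (Fin n))) (Z : Matrix U U ℝ) (δ : ℝ) :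
    ℝ≥0 → ℝ :=
  fun t => ∑ x : U, ∑ y : U, Z x y *
    ∫ x' in Metric.ball (x : EuclideanSpace ℝ (Fin n)) δ,
      ∫ y' in Metric.ball (y : EuclideanSpace ℝ (Fin n)) δ, Omega n ((t : ℝ) * ‖x' - y'‖)

/-- The functions `thickFun U Z δ` for finite `U ⊆ ℚⁿ` with at least two points, `Z ∈ T U`, and
`δ = m(U) / (2k)` with `k ≥ 1` an integer, where `m(U)` (Mathlib's `Set.infsep`) is the minimal
distance between distinct points of `U`. -/
def thickFunctions {n : ℕ}
    (T : (U : Finset (EuclideanSpace ℝ (Fin n))) → Set (Matrix U U ℝ)) : Set (ℝ≥0 → ℝ) :=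
  {r | ∃ U : Finset (EuclideanSpace ℝ (Fin n)),
    U.Nontrivial ∧ (∀ x ∈ U, ∀ i, ∃ q : ℚ, x i = (q : ℝ)) ∧
    ∃ Z ∈ T U, ∃ k : ℕ, 1 ≤ k ∧
      r = thickFun U Z (Set.infsep (U : Set (EuclideanSpace ℝ (Fin n))) / (2 * (k : ℝ)))}

/-- The feasible solutions of the `N`th primal problem: Borel measures `α` on `[0, ∞)`.
The enumeration is indexed from `0`: its first `N` members are `r 0, …, r (N - 1)`. -/
def primalFeasible (n : ℕ) (r : ℕ → ℝ≥0 → ℝ) (N : ℕ) : Set (MeasureTheory.Measure ℝ≥0) :=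
  {α | α Set.univ = 1 ∧ ∫ t, Omega n (t : ℝ) ∂α = 0 ∧ ∀ k < N, 0 ≤ ∫ t, r k t ∂α}

/-- The objective values `α({0})` of the feasible solutions of the `N`th primal problem. -/
def primalValues (n : ℕ) (r : ℕ → ℝ≥0 → ℝ) (N : ℕ) : Set ℝ :=
  {v | ∃ α ∈ primalFeasible n r N, v = α.real {0}}

/-- The optimal value `ϑ_N` of the `N`th primal problem. -/
def theta (n : ℕ) (r : ℕ → ℝ≥0 → ℝ) (N : ℕ) : ℝ := sSup (primalValues n r N)

/-- The objective values `λ` of the feasible solutions `(λ, z, y)` of the `N`th dual problem. -/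
def dualValues (n : ℕ) (r : ℕ → ℝ≥0 → ℝ) (N : ℕ) : Set ℝ :=
  {l | ∃ (z : ℝ) (y : Fin N → ℝ),
    1 ≤ l + z + ∑ k : Fin N, y k * r k 0 ∧
    (∀ t : ℝ≥0, 0 < t → 0 ≤ l + z * Omega n (t : ℝ) + ∑ k : Fin N, y k * r k t) ∧
    ∀ k, y k ≤ 0}

end

open MeasureTheory Filter Topology
open scoped FourierTransform SchwartzMap ContDiff

/-! All constraint functions are continuous on `[0, ∞)` and vanish at infinity. For `Ω_n` this is
the Riemann–Lebesgue lemma, as the first coordinate on the sphere has an absolutely continuous law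
when `n ≥ 2` (`tendsto_Omega_cocompact`); dominated convergence carries it over to the thickened
functions (`tendsto_thickFun_atTop`).

Hence the vectors of constraint values at the points of `[0, ∞)`, together with the vector `0`, form
a compact set in a finite-dimensional space. Adding `0` means admitting measures of mass at most
`1`, since mass may escape to infinity. Strictly separating a convex hull built from this set from
the cone of admissible values gives a dual solution for every `l` above the relaxed optimum
(`exists_dual_solution`).

The relaxation costs nothing once some feasible `β` exists: a multiple of `β` fills up the missing
mass without lowering `α({0})`. Such a `β` is a dilate of a probability measure `ν` whose transform
`G(s) = ∫ Ω_n(st) dν(t)` is nonnegative with bounded support (`exists_measure_integral_Omega`). For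
a large factor `k` the `Ω_n`-constraint reads `G(k) = 0`, while `k ^ n` times the integral of a
thickened function tends to a positive multiple of `tr Z` (`exists_primalFeasible`). Weak duality is
integration of the dual inequalities. -/

/-! ### `Ω_n` as a characteristic function, and its decay. -/

/-- The law of the first coordinate of a uniformly distributed point of the unit sphere. -/
noncomputable def firstCoordLaw (n : ℕ) : Measure ℝ :=
  (((volume : Measure (EuclideanSpace ℝ (Fin n))).toSphere Set.univ)⁻¹ •
    (volume : Measure (EuclideanSpace ℝ (Fin n))).toSphere).map
    (fun ξ : Metric.sphere (0 : EuclideanSpace ℝ (Fin n)) 1 =>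
      inner ℝ (axisVec n 1) (ξ : EuclideanSpace ℝ (Fin n)))

theorem axisVec_eq_smul (n : ℕ) (t : ℝ) : axisVec n t = t • axisVec n 1 := by
  ext i
  simp [axisVec]

theorem measurable_inner_sphere {n : ℕ} (u : EuclideanSpace ℝ (Fin n)) :
    Measurable fun ξ : Metric.sphere (0 : EuclideanSpace ℝ (Fin n)) 1 =>
      (inner ℝ u (ξ : EuclideanSpace ℝ (Fin n)) : ℝ) := by
  have : Continuous fun ξ : Metric.sphere (0 : EuclideanSpace ℝ (Fin n)) 1 =>
      (inner ℝ u (ξ : EuclideanSpace ℝ (Fin n)) : ℝ) := by fun_prop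
  exact this.measurable

theorem isProbabilityMeasure_normalized_toSphere {n : ℕ} (hn : 1 ≤ n) :
    IsProbabilityMeasure (((volume : Measure (EuclideanSpace ℝ (Fin n))).toSphere Set.univ)⁻¹ •
    (volume : Measure (EuclideanSpace ℝ (Fin n))).toSphere) := by
  have : Nonempty (Fin n) := ⟨⟨0, hn⟩⟩
  have : NeZero (volume : Measure (EuclideanSpace ℝ (Fin n))).toSphere :=
    ⟨Measure.toSphere_ne_zero _⟩
  exact isProbabilityMeasureSMul

theorem isProbabilityMeasure_firstCoordLaw {n : ℕ} (hn : 1 ≤ n) :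
    IsProbabilityMeasure (firstCoordLaw n) := by
  have := isProbabilityMeasure_normalized_toSphere hn
  exact Measure.isProbabilityMeasure_map (measurable_inner_sphere _).aemeasurable

/-- The exponent depends on the sphere point only through its first coordinate, so bounds,
continuity and decay reduce to a law on the line. -/
theorem Omega_eq_charFun (n : ℕ) (t : ℝ) : Omega n t = (charFun (firstCoordLaw n) t).re := by
  rw [Omega, charFun_apply_real, firstCoordLaw, integral_map (measurable_inner_sphere _).aemeasurable
    (by fun_prop)]
  unfold sphereAvg average
  congr 2
  ext ξ
  beta_reduce
  rw [axisVec_eq_smul, real_inner_smul_left]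
  push_cast
  ring_nf

theorem Omega_zero {n : ℕ} (hn : 1 ≤ n) : Omega n 0 = 1 := by
  have := isProbabilityMeasure_firstCoordLaw hn
  rw [Omega_eq_charFun]
  simp

theorem abs_Omega_le_one {n : ℕ} (hn : 1 ≤ n) (t : ℝ) : |Omega n t| ≤ 1 := by
  have := isProbabilityMeasure_firstCoordLaw hn
  rw [Omega_eq_charFun]
  exact (Complex.abs_re_le_norm _).trans (norm_charFun_le_one _)

theorem continuous_Omega {n : ℕ} (hn : 1 ≤ n) : Continuous (Omega n) := by
  have := isProbabilityMeasure_firstCoordLaw hn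
  have : Omega n = fun t => (charFun (firstCoordLaw n) t).re := funext (Omega_eq_charFun n)
  rw [this]
  have h : Continuous (charFun (firstCoordLaw n)) := by
    simp only [funext charFun_apply_real]
    refine continuous_of_dominated (bound := fun _ => 1) (fun t => ?_) (fun t => ?_) ?_ ?_
    · exact (by fun_prop : Continuous _).aestronglyMeasurable
    · refine ae_of_all _ fun x => le_of_eq ?_
      rw [← Complex.ofReal_mul, Complex.norm_exp_ofReal_mul_I]
    · exact integrable_const _
    · exact ae_of_all _ fun x => by fun_prop
  fun_prop

/-- The map `x ↦ x / √(x² + c)` pulls null sets back to null sets. -/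
theorem volume_preimage_div_sqrt_eq_zero {A : Set ℝ} (hA : volume A = 0) {c : ℝ} (hc : 0 < c) :
    volume {x : ℝ | x / √(x ^ 2 + c) ∈ A} = 0 := by
  have hsub : {x : ℝ | x / √(x ^ 2 + c) ∈ A} ⊆
      (fun s => √c * s / √(1 - s ^ 2)) '' (A ∩ Set.Ioo (-1) 1) := by
    intro x hx
    have hpos : 0 < x ^ 2 + c := by positivity
    have hs : (x / √(x ^ 2 + c)) ^ 2 = x ^ 2 / (x ^ 2 + c) := by
      rw [div_pow, Real.sq_sqrt hpos.le]
    have h1 : 1 - (x / √(x ^ 2 + c)) ^ 2 = c / (x ^ 2 + c) := by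
      rw [hs]; field_simp; ring
    refine ⟨x / √(x ^ 2 + c), ⟨hx, ?_⟩, ?_⟩
    · rw [Set.mem_Ioo, ← abs_lt, ← sq_lt_one_iff_abs_lt_one]
      have : 0 < c / (x ^ 2 + c) := by positivity
      linarith
    · simp only [h1]
      rw [Real.sqrt_div hc.le]
      have := Real.sqrt_pos.2 hc
      have := Real.sqrt_pos.2 hpos
      field_simp
  refine measure_mono_null hsub ?_
  refine addHaar_image_eq_zero_of_differentiableOn_of_addHaar_eq_zero volume ?_
    (measure_mono_null Set.inter_subset_left hA)
  rintro s ⟨-, hs⟩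
  have h1 : 0 < 1 - s ^ 2 := by nlinarith [hs.1, hs.2]
  have := (Real.sqrt_pos.2 h1).ne'
  exact ((by fun_prop : DifferentiableAt ℝ (fun s => √c * s) s).div
    ((by fun_prop : DifferentiableAt ℝ (fun s : ℝ => 1 - s ^ 2) s).sqrt h1.ne')
    this).differentiableWithinAt

theorem volume_setOf_coord_div_norm_mem_eq_zero {m : ℕ} {A : Set ℝ} (hm : MeasurableSet A)
    (hA : volume A = 0) :
    volume {x : EuclideanSpace ℝ (Fin (m + 2)) | x 0 / ‖x‖ ∈ A} = 0 := by
  set D : Set (ℝ × (Fin (m + 1) → ℝ)) :=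
    {p | p.1 / √(p.1 ^ 2 + ∑ i, p.2 i ^ 2) ∈ A} with hD
  have hDm : MeasurableSet D := by
    have : Measurable fun p : ℝ × (Fin (m + 1) → ℝ) => p.1 / √(p.1 ^ 2 + ∑ i, p.2 i ^ 2) := by
      fun_prop
    exact this hm
  have hD0 : volume D = 0 := by
    rw [Measure.volume_eq_prod, Measure.prod_apply_symm hDm, lintegral_eq_zero_iff
      (measurable_measure_prodMk_right hDm)]
    -- Slices fix all coordinates but the first. At least one remains, so `c = ∑ y i ^ 2` is
    -- positive for almost every `y`; this is where dimension at least 2 enters.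
    filter_upwards [Measure.ae_ne volume (0 : Fin (m + 1) → ℝ)] with y hy
    refine volume_preimage_div_sqrt_eq_zero (c := ∑ i, y i ^ 2) hA ?_
    obtain ⟨j, hj⟩ := Function.ne_iff.1 hy
    exact Finset.sum_pos' (fun i _ => sq_nonneg _) ⟨j, Finset.mem_univ _, by
      have : y j ≠ 0 := hj
      positivity⟩
  have hmp := (volume_preserving_piFinSuccAbove (fun _ : Fin (m + 2) => ℝ) 0).comp
    (PiLp.volume_preserving_ofLp (Fin (m + 2)))
  rw [← hD0, ← hmp.measure_preimage hDm.nullMeasurableSet]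
  congr 1
  ext x
  simp [hD, EuclideanSpace.norm_eq, Fin.sum_univ_succ]
  exact Iff.rfl

theorem firstCoordLaw_absolutelyContinuous {n : ℕ} (hn : 2 ≤ n) : firstCoordLaw n ≪ volume := by
  obtain ⟨m, rfl⟩ := Nat.exists_eq_add_of_le' hn
  refine Measure.AbsolutelyContinuous.mk fun A hA h0 => ?_
  rw [firstCoordLaw, Measure.map_apply (measurable_inner_sphere _) hA, Measure.smul_apply,
    Measure.toSphere_apply' _ (measurable_inner_sphere _ hA),
    measure_mono_null _ (volume_setOf_coord_div_norm_mem_eq_zero (m := m) hA h0)]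
  · simp
  -- Surface measure is the normalized volume of the cone over a set, and `x 0 / ‖x‖` is constant
  -- along rays.
  rintro _ ⟨c, hc, _, ⟨ξ, hξ, rfl⟩, rfl⟩
  have h1 : ‖(ξ : EuclideanSpace ℝ (Fin (m + 2)))‖ = 1 := by simp
  have h2 : inner ℝ (axisVec (m + 2) 1) (ξ : EuclideanSpace ℝ (Fin (m + 2))) =
      (ξ : EuclideanSpace ℝ (Fin (m + 2))) 0 := by
    simp [axisVec, PiLp.inner_apply]
  have hc0 : c ≠ 0 := hc.1.ne'
  simp only [Set.mem_preimage, h2] at hξ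
  simp only [Set.mem_ofPred_eq, norm_smul, h1, PiLp.smul_apply, smul_eq_mul, mul_one,
    Real.norm_eq_abs, abs_of_pos hc.1]
  rwa [mul_div_cancel_left₀ _ hc0]

/-- Riemann–Lebesgue for the Radon–Nikodym density; the factor `-(2π)⁻¹` converts between the two
Fourier conventions. -/
theorem tendsto_charFun_cocompact {μ : Measure ℝ} [IsFiniteMeasure μ] (h : μ ≪ volume) :
    Tendsto (charFun μ) (cocompact ℝ) (𝓝 0) := by
  have h1 := Real.tendsto_integral_exp_smul_cocompact
    (fun x => (((μ.rnDeriv volume x).toReal : ℝ) : ℂ))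
  have h2 : Tendsto (fun t : ℝ => -(2 * Real.pi)⁻¹ * t) (cocompact ℝ) (cocompact ℝ) := 
    (Homeomorph.mulLeft₀ (-(2 * Real.pi)⁻¹) (by simp [Real.pi_ne_zero])).isClosedEmbedding.tendsto_cocompact
  refine (h1.comp h2).congr fun t => ?_
  simp only [Function.comp_apply]
  rw [charFun_apply_real, ← integral_rnDeriv_smul h]
  refine integral_congr_ae (ae_of_all _ fun x => ?_)
  simp only [Real.fourierChar_apply, Circle.smul_def, smul_eq_mul, Complex.real_smul]
  rw [mul_comm]
  congr 2
  push_cast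
  have : (Real.pi : ℂ) ≠ 0 := by exact_mod_cast Real.pi_ne_zero
  field_simp

theorem tendsto_Omega_cocompact {n : ℕ} (hn : 2 ≤ n) :
    Tendsto (Omega n) (cocompact ℝ) (𝓝 0) := by
  have := isProbabilityMeasure_firstCoordLaw (n := n) (by omega)
  have := tendsto_charFun_cocompact (firstCoordLaw_absolutelyContinuous hn)
  have h := (Complex.continuous_re.tendsto 0).comp this
  exact h.congr fun t => (Omega_eq_charFun n t).symm

/-! ### Continuity and decay of the thickened functions. -/

theorem norm_setIntegral_ball_le {n : ℕ} {f : EuclideanSpace ℝ (Fin n) → ℝ} (hf : ∀ x, |f x| ≤ 1)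
    (y : EuclideanSpace ℝ (Fin n)) (δ : ℝ) :
    ‖∫ y' in Metric.ball y δ, f y'‖ ≤ volume.real (Metric.ball y δ) := by
  simpa using norm_setIntegral_le_of_norm_le_const (C := 1) (f := f)
    (measure_ball_lt_top (x := y) (r := δ) (μ := volume)) (fun x _ => hf x)

theorem stronglyMeasurable_setIntegral_dist {n : ℕ} {K : ℝ → ℝ} (hK : Continuous K)
    (s : Set (EuclideanSpace ℝ (Fin n))) :
    StronglyMeasurable fun x' : EuclideanSpace ℝ (Fin n) => ∫ y' in s, K ‖x' - y'‖ := by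
  have : Continuous fun p : EuclideanSpace ℝ (Fin n) × EuclideanSpace ℝ (Fin n) =>
      K ‖p.1 - p.2‖ := by fun_prop
  exact this.stronglyMeasurable.integral_prod_right'

/-- Convergence at `d = 0` is not needed because the diagonal `x' = y'` is null. This allows the
limit `0` for `Ω_n(td)`, which equals `1` at `d = 0` for all `t`. -/
theorem tendsto_integral_ball_ball {n : ℕ} (hn : 1 ≤ n) {ι : Type*} {l : Filter ι}
    [l.IsCountablyGenerated] {K : ι → ℝ → ℝ} {K₀ : ℝ → ℝ} (hK : ∀ i, Continuous (K i))
    (hb : ∀ i d, |K i d| ≤ 1) (hl : ∀ d, 0 < d → Tendsto (fun i => K i d) l (𝓝 (K₀ d)))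
    (x y : EuclideanSpace ℝ (Fin n)) (δ : ℝ) :
    Tendsto (fun i => ∫ x' in Metric.ball x δ, ∫ y' in Metric.ball y δ, K i ‖x' - y'‖) l
      (𝓝 (∫ x' in Metric.ball x δ, ∫ y' in Metric.ball y δ, K₀ ‖x' - y'‖)) := by
  have : Nonempty (Fin n) := ⟨⟨0, hn⟩⟩
  have hfin : ∀ z : EuclideanSpace ℝ (Fin n),
      IsFiniteMeasure (volume.restrict (Metric.ball z δ)) :=
    fun z => isFiniteMeasure_restrict.2 measure_ball_lt_top.ne
  refine tendsto_integral_filter_of_dominated_convergence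
    (fun _ => volume.real (Metric.ball y δ)) (.of_forall fun i => ?_) (.of_forall fun i => ?_)
    (integrable_const _) (ae_of_all _ fun x' => ?_)
  · exact (stronglyMeasurable_setIntegral_dist (hK i) _).aestronglyMeasurable
  · exact ae_of_all _ fun x' => norm_setIntegral_ball_le (fun _ => hb i _) y δ
  · refine tendsto_integral_filter_of_dominated_convergence (fun _ => 1)
      (.of_forall fun i => ?_) (.of_forall fun i => ?_) (integrable_const _) ?_
    · exact ((hK i).comp (by fun_prop)).aestronglyMeasurable
    · exact ae_of_all _ fun y' => hb i _
    · filter_upwards [Measure.ae_ne _ x'] with y' hy'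
      exact hl _ (norm_pos_iff.2 (sub_ne_zero.2 hy'.symm))

theorem continuous_thickFun {n : ℕ} (hn : 1 ≤ n) (U : Finset (EuclideanSpace ℝ (Fin n)))
    (Z : Matrix U U ℝ) (δ : ℝ) : Continuous (thickFun U Z δ) := by
  refine continuous_finsetSum _ fun x _ => continuous_finsetSum _ fun y _ =>
    continuous_const.mul (continuous_iff_continuousAt.2 fun t₀ => ?_)
  have hΩ := continuous_Omega hn
  exact tendsto_integral_ball_ball hn (K := fun (t : ℝ≥0) d => Omega n ((t : ℝ) * d))
    (K₀ := fun d => Omega n ((t₀ : ℝ) * d)) (fun i => by fun_prop)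
    (fun _ _ => abs_Omega_le_one hn _)
    (fun d _ => (by fun_prop : Continuous fun t : ℝ≥0 => Omega n ((t : ℝ) * d)).tendsto t₀) _ _ _

theorem tendsto_Omega_mul_atTop {n : ℕ} (hn : 2 ≤ n) {d : ℝ} (hd : 0 < d) :
    Tendsto (fun t : ℝ≥0 => Omega n ((t : ℝ) * d)) atTop (𝓝 0) :=
  ((tendsto_Omega_cocompact hn).mono_left atTop_le_cocompact).comp
    ((NNReal.tendsto_coe_atTop.2 tendsto_id).atTop_mul_const hd)

theorem tendsto_thickFun_atTop {n : ℕ} (hn : 2 ≤ n) (U : Finset (EuclideanSpace ℝ (Fin n)))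
    (Z : Matrix U U ℝ) (δ : ℝ) : Tendsto (thickFun U Z δ) atTop (𝓝 0) := by
  have hn1 : 1 ≤ n := by omega
  have hΩ := continuous_Omega hn1
  have h : ∀ x y : U, Tendsto (fun t : ℝ≥0 => Z x y *
      ∫ x' in Metric.ball (x : EuclideanSpace ℝ (Fin n)) δ,
        ∫ y' in Metric.ball (y : EuclideanSpace ℝ (Fin n)) δ, Omega n ((t : ℝ) * ‖x' - y'‖))
      atTop (𝓝 0) := fun x y => by
    simpa using (tendsto_integral_ball_ball hn1 (l := atTop)
      (K := fun (t : ℝ≥0) d => Omega n ((t : ℝ) * d)) (K₀ := fun _ => 0) (fun i => by fun_prop)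
      (fun _ _ => abs_Omega_le_one hn1 _) (fun d hd => tendsto_Omega_mul_atTop hn hd)
      (x : EuclideanSpace ℝ (Fin n)) y δ).const_mul (Z x y)
  have hsum := tendsto_finsetSum (Finset.univ : Finset U) fun x _ =>
    tendsto_finsetSum (Finset.univ : Finset U) fun y _ => h x y
  simp only [Finset.sum_const_zero] at hsum
  exact hsum

/-! ### Compactness of convex hulls. -/

/-- In a finite-dimensional space the convex hull of a compact set is compact. -/
theorem IsCompact.convexHull_of_finiteDimensional {E : Type*} [NormedAddCommGroup E]
    [NormedSpace ℝ E] [FiniteDimensional ℝ E] {s : Set E} (hs : IsCompact s) :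
    IsCompact (convexHull ℝ s) := by
  classical
  rcases s.eq_empty_or_nonempty with rfl | ⟨p, hp⟩
  · simp
  set d := Module.finrank ℝ E + 1 with hd
  -- Carathéodory: `finrank + 1` points suffice. Shorter families are padded with weight `0` at the
  -- point `p`, so the hull is a continuous image of a compact set.
  have himage : convexHull ℝ s = (fun q : (Fin d → ℝ) × (Fin d → E) => ∑ i, q.1 i • q.2 i) ''
      (stdSimplex ℝ (Fin d) ×ˢ Set.univ.pi fun _ => s) := by
    ext x
    constructor
    · intro hx
      obtain ⟨ι, _, z, w, hz, hind, hw, hw1, hx⟩ := eq_pos_convex_span_of_mem_convexHull hx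
      have hcard : Fintype.card ι ≤ Fintype.card (Fin d) := by
        rw [Fintype.card_fin, hd]
        exact hind.card_le_finrank_succ.trans
          (Nat.add_le_add_right (Submodule.finrank_le _) 1)
      obtain ⟨e⟩ := Function.Embedding.nonempty_of_card_le hcard
      have hsum : ∀ i, Function.extend e w 0 (e i) = w i := e.injective.extend_apply w 0
      refine ⟨(Function.extend e w 0, Function.extend e z fun _ => p), ⟨⟨fun j => ?_, ?_⟩,
        fun j _ => ?_⟩, ?_⟩
      · by_cases hj : ∃ i, e i = j
        · obtain ⟨i, rfl⟩ := hj
          simpa [hsum] using (hw i).le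
        · simp [Function.extend_apply' _ _ _ hj]
      · rw [← hw1]
        refine (Fintype.sum_of_injective e e.injective _ _ (fun j hj => ?_) fun i => ?_).symm
        · exact Function.extend_apply' _ _ _ hj
        · exact (hsum i).symm
      · by_cases hj : ∃ i, e i = j
        · obtain ⟨i, rfl⟩ := hj
          simpa [e.injective.extend_apply] using hz ⟨i, rfl⟩
        · simpa [Function.extend_apply' _ _ _ hj] using hp
      · rw [← hx]
        refine (Fintype.sum_of_injective e e.injective _ _ (fun j hj => ?_) fun i => ?_).symm
        · simp [Function.extend_apply' w _ _ hj]
        · simp [e.injective.extend_apply]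
    · rintro ⟨⟨w, z⟩, ⟨⟨hw, hw1⟩, hz⟩, rfl⟩
      exact (convex_convexHull ℝ s).sum_mem (fun i _ => hw i) hw1
        fun i _ => subset_convexHull ℝ s (hz i trivial)
  rw [himage]
  exact ((isCompact_stdSimplex ℝ (Fin d)).prod (isCompact_univ_pi fun _ => hs)).image (by fun_prop)

/-! ### Abstract strong duality by separation. -/

section Duality

variable {X : Type*} [TopologicalSpace X] [MeasurableSpace X] [BorelSpace X]

/-- A continuous function that vanishes at infinity is integrable for every finite measure. -/
theorem integrable_of_tendsto_cocompact {h : X → ℝ} (hc : Continuous h)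
    (h0 : Tendsto h (cocompact X) (𝓝 0)) (α : Measure X) [IsFiniteMeasure α] : Integrable h α := by
  obtain ⟨C, hC⟩ := (h0.isCompact_insert_range_of_cocompact hc).isBounded.exists_norm_le
  exact Integrable.of_bound hc.aestronglyMeasurable C
    (ae_of_all _ fun x => hC _ (Set.mem_insert_of_mem _ ⟨x, rfl⟩))

/-- For continuous functions `g` and `f k` that vanish at infinity: if every measure `α` of mass at
most `1` with `∫ g ∂α = 0` and `∫ f k ∂α ≥ 0` satisfies `α {o} < l`, then `l` is the value of a
solution of the dual problem. -/
theorem exists_dual_solution [MeasurableSingletonClass X] {ι : Type*} [Fintype ι]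
    {g : X → ℝ} {f : ι → X → ℝ}
    (hg : Continuous g) (hf : ∀ k, Continuous (f k)) (hg0 : Tendsto g (cocompact X) (𝓝 0))
    (hf0 : ∀ k, Tendsto (f k) (cocompact X) (𝓝 0)) (o : X) {l : ℝ}
    (hl : ∀ α : Measure X, α Set.univ ≤ 1 → ∫ x, g x ∂α = 0 → (∀ k, 0 ≤ ∫ x, f k x ∂α) →
      α.real {o} < l) :
    ∃ (z : ℝ) (y : ι → ℝ), (∀ k, y k ≤ 0) ∧ 1 ≤ l + z * g o + ∑ k, y k * f k o ∧
      ∀ x, 0 ≤ l + z * g x + ∑ k, y k * f k x := by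
  classical
  set M : Set (ℝ × ℝ × (ι → ℝ)) := {v | ∃ α : Measure X, α Set.univ ≤ 1 ∧
    l - α.real {o} ≤ v.1 ∧ ∫ x, g x ∂α = v.2.1 ∧ ∀ k, ∫ x, f k x ∂α = v.2.2 k} with hM
  have hfin : ∀ α : Measure X, α Set.univ ≤ 1 → IsFiniteMeasure α :=
    fun α h => ⟨h.trans_lt ENNReal.one_lt_top⟩
  have hMconv : Convex ℝ M := by
    rintro v ⟨α, hα, hαo, hαg, hαf⟩ w ⟨β, hβ, hβo, hβg, hβf⟩ a b ha hb hab
    have hα' := hfin α hα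
    have hβ' := hfin β hβ
    have hadd : ∀ h : X → ℝ, Continuous h → Tendsto h (cocompact X) (𝓝 0) →
        ∫ x, h x ∂(ENNReal.ofReal a • α + ENNReal.ofReal b • β) =
          a * ∫ x, h x ∂α + b * ∫ x, h x ∂β := fun h hc h0 => by
      rw [integral_add_measure ((integrable_of_tendsto_cocompact hc h0 α).smul_measure ENNReal.ofReal_ne_top)
        ((integrable_of_tendsto_cocompact hc h0 β).smul_measure ENNReal.ofReal_ne_top), integral_smul_measure,
        integral_smul_measure, ENNReal.toReal_ofReal ha, ENNReal.toReal_ofReal hb,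
        smul_eq_mul, smul_eq_mul]
    refine ⟨ENNReal.ofReal a • α + ENNReal.ofReal b • β, ?_, ?_, ?_, fun k => ?_⟩
    · calc (ENNReal.ofReal a • α + ENNReal.ofReal b • β) Set.univ
          = ENNReal.ofReal a * α Set.univ + ENNReal.ofReal b * β Set.univ := by simp
        _ ≤ ENNReal.ofReal a * 1 + ENNReal.ofReal b * 1 := by gcongr
        _ = 1 := by rw [mul_one, mul_one, ← ENNReal.ofReal_add ha hb, hab, ENNReal.ofReal_one]
    · have h1 : (ENNReal.ofReal a • α + ENNReal.ofReal b • β).real {o} =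
          a * α.real {o} + b * β.real {o} := by
        simp [measureReal_def, ENNReal.toReal_add, ENNReal.mul_eq_top, ha, hb]
      rw [h1]
      simp only [Prod.fst_add, Prod.smul_fst, smul_eq_mul]
      have h2 : l = a * l + b * l := by rw [← add_mul, hab, one_mul]
      linarith [mul_le_mul_of_nonneg_left hαo ha, mul_le_mul_of_nonneg_left hβo hb]
    · rw [hadd g hg hg0, hαg, hβg]
      rfl
    · rw [hadd _ (hf k) (hf0 k), hαf, hβf]
      rfl
  set P : X → ℝ × (ι → ℝ) := fun x => (g x, fun k => f k x) with hP
  have hPc : IsCompact (insert 0 (Set.range P)) :=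
    Tendsto.isCompact_insert_range_of_cocompact
      (hg0.prodMk_nhds (tendsto_pi_nhds.2 hf0)) (hg.prodMk (continuous_pi hf))
  -- The mass of `{o}` is not weakly continuous in the measure, so the atom at `o` gets a separate
  -- point. The point `(l, P o)` also stays in `Q`; the inequality in the first coordinate of `M`
  -- accommodates it. The vector `0` stands for the zero measure.
  set Q : Set (ℝ × ℝ × (ι → ℝ)) :=
    insert (l - 1, P o) ((fun v => (l, v)) '' insert 0 (Set.range P)) with hQ
  have hQc : IsCompact Q := (hPc.image (by fun_prop)).insert _
  have hQM : convexHull ℝ Q ⊆ M := by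
    refine convexHull_min ?_ hMconv
    rintro v (rfl | ⟨w, (rfl | ⟨x, rfl⟩), rfl⟩)
    · exact ⟨Measure.dirac o, by simp, by simp [measureReal_def], by simp [hP], by simp [hP]⟩
    · exact ⟨0, by simp, by simp, by simp, by simp⟩
    · exact ⟨Measure.dirac x, by simp, by simp, by simp [hP], by simp [hP]⟩
  set S : Set (ℝ × ℝ × (ι → ℝ)) := Set.Iic 0 ×ˢ ({0} ×ˢ Set.Ici 0) with hS
  have hSmem : ∀ s b w, s ≤ 0 → b = 0 → 0 ≤ w → (s, b, w) ∈ S :=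
    fun _ _ _ h1 h2 h3 => ⟨h1, h2, h3⟩
  have hdisj : Disjoint S (convexHull ℝ Q) := by
    refine Set.disjoint_left.2 ?_
    rintro ⟨s, b, w⟩ ⟨hs, hb, hw⟩ hv
    obtain ⟨α, hα, hαo, hαg, hαf⟩ := hQM hv
    have := hl α hα (hαg.trans hb) fun k => by
      rw [hαf]
      exact hw k
    simp only [Set.mem_Iic] at hs hαo
    linarith
  obtain ⟨F, u, v, hFS, huv, hFQ⟩ := geometric_hahn_banach_closed_compact
    ((convex_Iic 0).prod ((convex_singleton 0).prod (convex_Ici 0)))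
    (isClosed_Iic.prod (isClosed_singleton.prod isClosed_Ici)) (convex_convexHull ℝ Q)
    hQc.convexHull_of_finiteDimensional hdisj
  have hu : 0 < u := by simpa using hFS 0 (hSmem 0 0 0 le_rfl rfl le_rfl)
  have hpos : ∀ q ∈ Q, 0 < F q :=
    fun q hq => hu.trans (huv.trans (hFQ q (subset_convexHull ℝ Q hq)))
  -- `S` is a cone, so a linear functional bounded above on it is nonpositive there.
  have hneg : ∀ s ∈ S, F s ≤ 0 := by
    rintro ⟨s, b, w⟩ ⟨h1, h2, h3⟩
    by_contra! hs
    have hc : 0 ≤ u / F (s, b, w) := by positivity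
    have := hFS ((u / F (s, b, w)) • (s, b, w)) (hSmem _ _ _
      (mul_nonpos_of_nonneg_of_nonpos hc h1) (mul_eq_zero_of_right _ h2) (smul_nonneg hc h3))
    rw [map_smul, smul_eq_mul, div_mul_cancel₀ _ hs.ne'] at this
    exact this.false
  have hF : ∀ s b w, F (s, b, w) =
      s * F (1, 0, 0) + (b * F (0, 1, 0) + ∑ k, w k * F (0, 0, Pi.single k 1)) := by
    intro s b w
    have hdec : ((s, b, w) : ℝ × ℝ × (ι → ℝ)) = s • (1, 0, 0) + (b • (0, 1, 0) +
        ∑ k, w k • ((0, 0, Pi.single k 1) : ℝ × ℝ × (ι → ℝ))) := by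
      refine Prod.ext ?_ (Prod.ext ?_ ?_)
      · simp [Prod.fst_sum]
      · simp [Prod.fst_sum, Prod.snd_sum]
      · ext j
        simp [Prod.snd_sum, Finset.sum_apply, Pi.single_apply]
    conv_lhs => rw [hdec]
    simp only [map_add, map_smul, map_sum, smul_eq_mul]
  set a := F (1, 0, 0) with ha
  have ha0 : 0 ≤ a := by
    have := hneg (-1, 0, 0) (hSmem _ _ _ (by simp) rfl le_rfl)
    rw [hF] at this
    simpa using this
  -- The zero measure rules out a vertical hyperplane: positivity at `(l, 0)` forces `a ≠ 0`, so one
  -- may divide by `a`.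
  have hal : 0 < l * a := by
    have := hpos (l, 0) (Or.inr ⟨0, Or.inl rfl, rfl⟩)
    rw [show ((l, 0) : ℝ × ℝ × (ι → ℝ)) = (l, 0, 0) from rfl, hF] at this
    simpa using this
  have ha1 : 0 < a := ha0.lt_of_ne fun h => by simp [← h] at hal
  have hscale : ∀ s b w, 0 < F (s, b, w) →
      0 < s + F (0, 1, 0) / a * b + ∑ k, F (0, 0, Pi.single k 1) / a * w k := by
    intro s b w h
    have h2 : s + F (0, 1, 0) / a * b + ∑ k, F (0, 0, Pi.single k 1) / a * w k =
        F (s, b, w) / a := by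
      rw [hF s b w, add_div, add_div, Finset.sum_div, mul_div_cancel_right₀ _ ha1.ne', add_assoc]
      congr 2
      · ring
      · exact Finset.sum_congr rfl fun k _ => by ring
    rw [h2]
    positivity
  refine ⟨F (0, 1, 0) / a, fun k => F (0, 0, Pi.single k 1) / a, fun k => ?_, ?_, fun x => ?_⟩
  · refine div_nonpos_of_nonpos_of_nonneg (hneg _ (hSmem _ _ _ le_rfl rfl ?_)) ha0
    exact Pi.single_nonneg.2 zero_le_one
  · have := hscale _ _ _ (hpos (l - 1, P o) (Or.inl rfl))
    linarith
  · exact (hscale _ _ _ (hpos (l, P x) (Or.inr ⟨_, Or.inr ⟨x, rfl⟩, rfl⟩))).le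

end Duality

/-! ### A probability measure with nonnegative, compactly supported transform. -/

section Spectral

variable {V : Type*} [NormedAddCommGroup V] [InnerProductSpace ℝ V] [FiniteDimensional ℝ V]
  [MeasurableSpace V] [BorelSpace V]

theorem SchwartzMap.fourier_compSubConstCLM (f : 𝓢(V, ℂ)) (a u : V) :
    𝓕 (f.compSubConstCLM ℂ a) u = Complex.exp (-(2 * Real.pi * inner ℝ a u : ℝ) * Complex.I) *
      𝓕 f u := by
  have h := congrFun (VectorFourier.fourierIntegral_comp_add_right Real.fourierChar volume
    (innerₗ V) (f : V → ℂ) (-a)) u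
  have h1 : (f.compSubConstCLM ℂ a : V → ℂ) = fun v => f (v + -a) := by
    ext v
    simp [sub_eq_add_neg]
  rw [SchwartzMap.fourier_coe, SchwartzMap.fourier_coe, Real.fourier_eq, Real.fourier_eq, h1]
  simp only [VectorFourier.fourierIntegral] at h
  refine h.trans ?_
  rw [Circle.smul_def, smul_eq_mul, Real.fourierChar_apply]
  congr 2
  simp

/-- There is a probability measure whose characteristic function is nonnegative and compactly
supported. -/
theorem exists_charFun_nonneg_compactSupport : ∃ ν : Measure V, IsProbabilityMeasure ν ∧
    ∃ b : V → ℝ, (∀ a, charFun ν a = b a) ∧ (∀ a, 0 ≤ b a) ∧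
      ∃ R : ℝ, 0 < R ∧ ∀ a, R ≤ ‖a‖ → b a = 0 := by
  let ψ : ContDiffBump (0 : V) := ⟨1, 2, one_pos, one_lt_two⟩
  have hcs : HasCompactSupport fun x : V => (ψ x : ℂ) :=
    ψ.hasCompactSupport.comp_left (g := fun r : ℝ => (r : ℂ)) rfl
  let f : 𝓢(V, ℂ) := hcs.toSchwartzMap
    (Complex.ofRealCLM.contDiff.comp ψ.contDiff)
  have hf : ∀ x, f x = ψ x := fun x => rfl
  have hint : Integrable (fun u => ‖𝓕 f u‖ ^ 2) (volume : Measure V) :=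
    ((𝓕 f).memLp 2 volume).integrable_norm_pow (by norm_num)
  -- By Plancherel, the transform of `‖𝓕 f‖ ^ 2` is the autocorrelation of the bump `ψ`:
  -- nonnegative, and zero once `‖a‖ / (2π) ≥ 4`, twice the outer radius of `ψ`.
  have hplancherel : ∀ a : V, ∫ u, Complex.exp (inner ℝ u a * Complex.I) * (‖𝓕 f u‖ ^ 2 : ℝ) =
      (∫ x, ψ x * ψ (x + (2 * Real.pi)⁻¹ • a) : ℝ) := fun a => by
    have h := SchwartzMap.integral_inner_fourier_fourier f
      (f.compSubConstCLM ℂ (-(2 * Real.pi)⁻¹ • a))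
    rw [← integral_complex_ofReal]
    convert h using 1
    · congr 1
      ext u
      rw [SchwartzMap.fourier_compSubConstCLM, RCLike.inner_apply, mul_assoc, RCLike.mul_conj,
        inner_smul_left, real_inner_comm]
      have : (Real.pi : ℂ) ≠ 0 := by exact_mod_cast Real.pi_ne_zero
      congr 2
      · simp
        field_simp
      · simp
    · congr 1
      ext x
      rw [SchwartzMap.compSubConstCLM_apply, hf, hf]
      simp [mul_comm]
  set c : ℝ := ∫ u, ‖𝓕 f u‖ ^ 2 with hc
  have hc0 : 0 < c := by
    rw [hc, SchwartzMap.integral_norm_sq_fourier]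
    refine Continuous.integral_pos_of_hasCompactSupport_nonneg_nonzero (x := 0) (by fun_prop)
      (hcs.comp_left (g := fun z : ℂ => ‖z‖ ^ 2) (by simp)) (fun x => by positivity) ?_
    rw [hf, ψ.one_of_mem_closedBall (by simp [ψ])]
    simp
  refine ⟨volume.withDensity fun u => ENNReal.ofReal (c⁻¹ * ‖𝓕 f u‖ ^ 2), ⟨?_⟩,
    fun a => c⁻¹ * ∫ x, ψ x * ψ (x + (2 * Real.pi)⁻¹ • a), fun a => ?_, fun a => ?_,
    2 * Real.pi * 4, by positivity, fun a ha => ?_⟩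
  · rw [withDensity_apply _ .univ, Measure.restrict_univ,
      ← ofReal_integral_eq_lintegral_ofReal (hint.const_mul _)
        (ae_of_all _ fun u => by positivity), integral_const_mul, ← hc, inv_mul_cancel₀ hc0.ne',
      ENNReal.ofReal_one]
  · have hmeas : Measurable fun u => ENNReal.ofReal (c⁻¹ * ‖𝓕 f u‖ ^ 2) := by
      have : Continuous fun u => 𝓕 f u := (𝓕 f).continuous
      fun_prop
    rw [charFun_apply, integral_withDensity_eq_integral_toReal_smul hmeas
      (ae_of_all _ fun u => ENNReal.ofReal_lt_top), Complex.ofReal_mul, ← hplancherel,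
      ← integral_const_mul]
    refine integral_congr_ae (ae_of_all _ fun u => ?_)
    beta_reduce
    rw [ENNReal.toReal_ofReal (by positivity), Complex.real_smul]
    push_cast
    ring
  · exact mul_nonneg (by positivity) (integral_nonneg fun x => mul_nonneg ψ.nonneg ψ.nonneg)
  · have : ∀ x : V, ψ x * ψ (x + (2 * Real.pi)⁻¹ • a) = 0 := fun x => by
      by_cases hx : 2 ≤ ‖x‖
      · rw [ψ.zero_of_le_dist (by simpa using hx), zero_mul]
      · rw [ψ.zero_of_le_dist (x := x + (2 * Real.pi)⁻¹ • a), mul_zero]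
        have h1 : 4 ≤ ‖(2 * Real.pi)⁻¹ • a‖ := by
          rw [norm_smul, Real.norm_eq_abs, abs_of_pos (by positivity), le_inv_mul_iff₀ (by positivity)]
          exact ha
        have h2 := norm_sub_le (x + (2 * Real.pi)⁻¹ • a) x
        rw [add_sub_cancel_left] at h2
        rw [dist_zero_right]
        show (2 : ℝ) ≤ _
        linarith [not_le.1 hx]
    simp only [this, integral_zero, mul_zero]

end Spectral

/-- Push the measure on `ℝⁿ` forward under the norm. By Fubini, its transform at `s` is the average
of `b` over the sphere of radius `s`, which inherits sign and support. -/
theorem exists_measure_integral_Omega {n : ℕ} (hn : 1 ≤ n) :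
    ∃ ν : Measure ℝ≥0, IsProbabilityMeasure ν ∧ ∃ R : ℝ, 0 < R ∧
      (∀ s, 0 ≤ s → 0 ≤ ∫ t, Omega n (s * (t : ℝ)) ∂ν) ∧
      ∀ s, R ≤ s → ∫ t, Omega n (s * (t : ℝ)) ∂ν = 0 := by
  obtain ⟨ν, hν, b, hb, hb0, R, hR, hbR⟩ :=
    exists_charFun_nonneg_compactSupport (V := EuclideanSpace ℝ (Fin n))
  set σ := ((volume : Measure (EuclideanSpace ℝ (Fin n))).toSphere Set.univ)⁻¹ •
    (volume : Measure (EuclideanSpace ℝ (Fin n))).toSphere with hσ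
  have : IsProbabilityMeasure σ := isProbabilityMeasure_normalized_toSphere hn
  have hΩ := continuous_Omega hn
  have key : ∀ s, 0 ≤ s → ∫ t, Omega n (s * (t : ℝ)) ∂(ν.map fun u => ‖u‖₊) =
      ∫ ξ : Metric.sphere (0 : EuclideanSpace ℝ (Fin n)) 1,
        b (s • (ξ : EuclideanSpace ℝ (Fin n))) ∂σ := fun s hs => by
    rw [integral_map (by fun_prop) (by fun_prop)]
    apply Complex.ofReal_injective
    rw [← integral_complex_ofReal, ← integral_complex_ofReal]
    calc ∫ u, ((Omega n (s * (‖u‖₊ : ℝ)) : ℝ) : ℂ) ∂ν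
        = ∫ u, ∫ ξ : Metric.sphere (0 : EuclideanSpace ℝ (Fin n)) 1,
          Complex.exp ((inner ℝ u (s • (ξ : EuclideanSpace ℝ (Fin n))) : ℝ) * Complex.I) ∂σ ∂ν := by
          refine integral_congr_ae (ae_of_all _ fun u => ?_)
          have h1 : s * (‖u‖₊ : ℝ) = ‖s • u‖ := by
            rw [norm_smul, Real.norm_eq_abs, abs_of_nonneg hs, coe_nnnorm]
          beta_reduce
          rw [h1, Omega_norm hn]
          refine integral_congr_ae (ae_of_all _ fun ξ => ?_)
          beta_reduce
          rw [mul_comm, real_inner_smul_left, real_inner_smul_right]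
      _ = ∫ ξ : Metric.sphere (0 : EuclideanSpace ℝ (Fin n)) 1, ∫ u,
          Complex.exp ((inner ℝ u (s • (ξ : EuclideanSpace ℝ (Fin n))) : ℝ) * Complex.I) ∂ν ∂σ := by
          refine integral_integral_swap (Integrable.of_bound (C := 1) ?_ (ae_of_all _ fun p => ?_))
          · exact (by fun_prop : Continuous _).aestronglyMeasurable
          · simp only [Function.uncurry]
            rw [Complex.norm_exp_ofReal_mul_I]
      _ = _ := integral_congr_ae (ae_of_all _ fun ξ => hb _)
  refine ⟨ν.map fun u => ‖u‖₊, Measure.isProbabilityMeasure_map (by fun_prop), R, hR,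
    fun s hs => ?_, fun s hs => ?_⟩
  · rw [key s hs]
    exact integral_nonneg fun ξ => hb0 _
  · have hs0 : 0 ≤ s := hR.le.trans hs
    rw [key s hs0]
    have : ∀ ξ : Metric.sphere (0 : EuclideanSpace ℝ (Fin n)) 1,
        b (s • (ξ : EuclideanSpace ℝ (Fin n))) = 0 := fun ξ => hbR _ (by
      rw [norm_smul, Real.norm_eq_abs, abs_of_nonneg hs0]
      simpa using hs)
    simp [this]

/-- Fubini moves the measure inside, so only its transform at the distances `‖x' - y'‖` matters. -/
theorem integral_thickFun {n : ℕ} (hn : 1 ≤ n) (U : Finset (EuclideanSpace ℝ (Fin n)))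
    (Z : Matrix U U ℝ) (δ : ℝ) (α : Measure ℝ≥0) [IsFiniteMeasure α] :
    ∫ t, thickFun U Z δ t ∂α = ∑ x : U, ∑ y : U, Z x y *
      ∫ x' in Metric.ball (x : EuclideanSpace ℝ (Fin n)) δ,
        ∫ y' in Metric.ball (y : EuclideanSpace ℝ (Fin n)) δ,
          ∫ t : ℝ≥0, Omega n ((t : ℝ) * ‖x' - y'‖) ∂α := by
  have hΩ := continuous_Omega hn
  have hfin : ∀ z : EuclideanSpace ℝ (Fin n),
      IsFiniteMeasure (volume.restrict (Metric.ball z δ)) :=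
    fun z => isFiniteMeasure_restrict.2 measure_ball_lt_top.ne
  have hint : ∀ x y : EuclideanSpace ℝ (Fin n), Integrable
      (fun p : ℝ≥0 × EuclideanSpace ℝ (Fin n) => ∫ y' in Metric.ball y δ,
        Omega n ((p.1 : ℝ) * ‖p.2 - y'‖)) (α.prod (volume.restrict (Metric.ball x δ))) :=
    fun x y => by
      refine Integrable.of_bound ?_ (volume.real (Metric.ball y δ)) (ae_of_all _ fun p =>
        norm_setIntegral_ball_le (fun _ => abs_Omega_le_one hn _) y δ)
      have : Continuous fun q : (ℝ≥0 × EuclideanSpace ℝ (Fin n)) × EuclideanSpace ℝ (Fin n) =>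
        Omega n ((q.1.1 : ℝ) * ‖q.1.2 - q.2‖) := by fun_prop
      exact (this.stronglyMeasurable.integral_prod_right').aestronglyMeasurable
  have hswap : ∀ x y : EuclideanSpace ℝ (Fin n),
      ∫ t : ℝ≥0, (∫ x' in Metric.ball x δ, ∫ y' in Metric.ball y δ,
        Omega n ((t : ℝ) * ‖x' - y'‖)) ∂α =
      ∫ x' in Metric.ball x δ, ∫ y' in Metric.ball y δ,
          ∫ t : ℝ≥0, Omega n ((t : ℝ) * ‖x' - y'‖) ∂α := fun x y => by
    rw [integral_integral_swap (hint x y)]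
    refine integral_congr_ae (ae_of_all _ fun x' => ?_)
    refine integral_integral_swap (Integrable.of_bound (C := 1) ?_
      (ae_of_all _ fun p => abs_Omega_le_one hn _))
    exact (by fun_prop : Continuous fun p : ℝ≥0 × EuclideanSpace ℝ (Fin n) =>
      Omega n ((p.1 : ℝ) * ‖x' - p.2‖)).aestronglyMeasurable
  have hintZ : ∀ x y : U, Integrable (fun t : ℝ≥0 => Z x y *
      ∫ x' in Metric.ball (x : EuclideanSpace ℝ (Fin n)) δ,
        ∫ y' in Metric.ball (y : EuclideanSpace ℝ (Fin n)) δ,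
          Omega n ((t : ℝ) * ‖x' - y'‖)) α :=
    fun x y => ((hint x y).integral_prod_left).const_mul _
  unfold thickFun
  rw [integral_finsetSum _ fun x _ => integrable_finsetSum _ fun y _ => hintZ x y]
  refine Finset.sum_congr rfl fun x _ => ?_
  rw [integral_finsetSum _ fun y _ => hintZ x y]
  refine Finset.sum_congr rfl fun y _ => ?_
  rw [integral_const_mul, hswap]

/-! ### Concentration of the dilated kernel on the diagonal. -/

section ApproximateIdentity

variable {n : ℕ} {G : ℝ → ℝ} {R : ℝ}

theorem integrable_comp_norm (hG : Continuous G) (hGR : ∀ s, R ≤ s → G s = 0) :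
    Integrable fun v : EuclideanSpace ℝ (Fin n) => G ‖v‖ := by
  refine Continuous.integrable_of_hasCompactSupport (by fun_prop)
    (HasCompactSupport.intro (isCompact_closedBall 0 R) fun v hv => hGR _ ?_)
  simpa using (not_le.1 (by simpa using hv : ¬ ‖v‖ ≤ R)).le

theorem pow_mul_integral_comp_norm_sub (x' : EuclideanSpace ℝ (Fin n)) {k : ℝ} (hk : 0 < k) :
    k ^ n * ∫ y' : EuclideanSpace ℝ (Fin n), G (k * ‖x' - y'‖) =
      ∫ v : EuclideanSpace ℝ (Fin n), G ‖v‖ := by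
  rw [integral_sub_left_eq_self (fun v : EuclideanSpace ℝ (Fin n) => G (k * ‖v‖)) volume x']
  have h := Measure.integral_comp_smul (volume : Measure (EuclideanSpace ℝ (Fin n)))
    (fun v => G ‖v‖) k
  simp only [norm_smul, Real.norm_eq_abs, abs_of_pos hk, finrank_euclideanSpace, Fintype.card_fin,
    smul_eq_mul] at h
  rw [h, abs_of_pos (by positivity), mul_inv_cancel_left₀ (by positivity)]

/-- The kernel `k ^ n * G (k * ‖x' - y'‖)` has constant total integral and range at most `R / k`.
Once this is below the distance `δ - dist x' x` from `x'` to the boundary of its ball, the inner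
integral equals its limit exactly. -/
theorem tendsto_pow_mul_integral_ball_ball (hG : Continuous G) (hG0 : ∀ s, 0 ≤ s → 0 ≤ G s)
    (hGR : ∀ s, R ≤ s → G s = 0) {x y : EuclideanSpace ℝ (Fin n)} {δ : ℝ}
    (hxy : x ≠ y → 2 * δ ≤ dist x y) [Decidable (x = y)] :
    Tendsto (fun k : ℝ≥0 => (k : ℝ) ^ n * ∫ x' in Metric.ball x δ, ∫ y' in Metric.ball y δ,
      G ((k : ℝ) * ‖x' - y'‖)) atTop
      (𝓝 (volume.real (Metric.ball x δ) *
        if x = y then ∫ v : EuclideanSpace ℝ (Fin n), G ‖v‖ else 0)) := by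
  have hfin : IsFiniteMeasure (volume.restrict (Metric.ball x δ)) :=
    isFiniteMeasure_restrict.2 measure_ball_lt_top.ne
  set w := ∫ v : EuclideanSpace ℝ (Fin n), G ‖v‖ with hw
  simp only [← integral_const_mul]
  have hlim : volume.real (Metric.ball x δ) * (if x = y then w else 0) =
      ∫ x' in Metric.ball x δ, if x = y then w else 0 := by simp
  rw [hlim]
  refine tendsto_integral_filter_of_dominated_convergence (fun _ => w) (.of_forall fun k => ?_) ?_
    (integrable_const _) (ae_restrict_of_forall_mem measurableSet_ball fun x' hx' => ?_)
  · simp only [integral_const_mul]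
    exact ((stronglyMeasurable_setIntegral_dist (K := fun d => G (k * d)) (by fun_prop)
      _).const_mul _).aestronglyMeasurable
  -- As `G ≥ 0`, the integral over all of `ℝⁿ` is a bound independent of `k` and `x'`.
  · filter_upwards [eventually_gt_atTop 0] with k hk
    have hk' : (0 : ℝ) < k := hk
    refine ae_of_all _ fun x' => ?_
    have hnn : ∀ y' : EuclideanSpace ℝ (Fin n), 0 ≤ G (k * ‖x' - y'‖) :=
      fun y' => hG0 _ (by positivity)
    rw [integral_const_mul, Real.norm_eq_abs, abs_of_nonneg
      (mul_nonneg (by positivity) (integral_nonneg hnn)), hw,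
      ← pow_mul_integral_comp_norm_sub x' hk']
    refine mul_le_mul_of_nonneg_left (setIntegral_le_integral ?_ (ae_of_all _ hnn)) (by positivity)
    have h1 := ((integrable_comp_norm (n := n) hG hGR).comp_smul hk'.ne').comp_sub_left x'
    simpa only [norm_smul, Real.norm_eq_abs, abs_of_pos hk'] using h1
  · have hgap : 0 < δ - dist x' x := sub_pos.2 hx'
    have hzero : ∀ᶠ k : ℝ≥0 in atTop, ∀ d, δ - dist x' x ≤ d → G (k * d) = 0 := by
      filter_upwards [(NNReal.tendsto_coe_atTop.2 tendsto_id).eventually_ge_atTop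
        (R / (δ - dist x' x))] with k hk d hd
      refine hGR _ (((div_le_iff₀ hgap).1 hk).trans ?_)
      exact mul_le_mul_of_nonneg_left hd k.2
    refine tendsto_const_nhds.congr' ?_
    filter_upwards [hzero, eventually_gt_atTop 0] with k hk hk0
    rw [integral_const_mul]
    split_ifs with h
    · subst h
      rw [setIntegral_eq_integral_of_forall_compl_eq_zero,
        pow_mul_integral_comp_norm_sub x' (NNReal.coe_pos.2 hk0)]
      intro y' hy'
      refine hk _ ?_
      have h1 : δ ≤ dist y' x := not_lt.1 hy'
      have h2 := dist_triangle y' x' x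
      rw [← dist_eq_norm, dist_comm x' y']
      linarith
    · rw [setIntegral_eq_zero_of_forall_eq_zero, mul_zero]
      intro y' hy'
      refine hk _ ?_
      have h1 : dist y' y < δ := hy'
      have h2 := dist_triangle4 x x' y' y
      have h3 := hxy h
      rw [← dist_eq_norm]
      rw [dist_comm x x'] at h2
      linarith

end ApproximateIdentity

/-! ### Feasibility and the absence of a gap. -/

/-- There are feasible measures for finitely many thickened functions of positive trace. -/
theorem exists_primalFeasible {n : ℕ} (hn : 1 ≤ n)
    {T : (U : Finset (EuclideanSpace ℝ (Fin n))) → Set (Matrix U U ℝ)} (hT : IsTipSelection T)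
    {r : ℕ → ℝ≥0 → ℝ} (hr : ∀ k, r k ∈ thickFunctions T) (N : ℕ) :
    (primalFeasible n r N).Nonempty := by
  classical
  obtain ⟨ν, hν, R, hR, hG0, hGR⟩ := exists_measure_integral_Omega hn
  set G : ℝ → ℝ := fun s => ∫ t : ℝ≥0, Omega n (s * (t : ℝ)) ∂ν with hGdef
  have hΩ := continuous_Omega hn
  have hG : Continuous G := by
    refine continuous_of_dominated (bound := fun _ => 1) (fun s => ?_)
      (fun s => ae_of_all _ fun t => abs_Omega_le_one hn _) (integrable_const _)
      (ae_of_all _ fun t => by fun_prop)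
    exact (by fun_prop : Continuous fun t : ℝ≥0 => Omega n (s * (t : ℝ))).aestronglyMeasurable
  have hG1 : G 0 = 1 := by simp [hGdef, Omega_zero hn]
  have hw : 0 < ∫ v : EuclideanSpace ℝ (Fin n), G ‖v‖ :=
    integral_pos_of_integrable_nonneg_nonzero (x := 0) (by fun_prop) (integrable_comp_norm hG hGR)
      (fun v => hG0 _ (norm_nonneg _)) (by simp [hG1])
  have hmap : ∀ (k : ℝ≥0) (d : ℝ), ∫ t : ℝ≥0, Omega n ((t : ℝ) * d) ∂(ν.map fun t => k * t) =
      G (k * d) := fun k d => by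
    rw [integral_map (by fun_prop) (by fun_prop)]
    refine integral_congr_ae (ae_of_all _ fun t => ?_)
    beta_reduce
    push_cast
    ring_nf
  have hprob : ∀ k : ℝ≥0, IsProbabilityMeasure (ν.map fun t => k * t) :=
    fun k => Measure.isProbabilityMeasure_map (by fun_prop)
  have hev : ∀ j, ∀ᶠ k : ℝ≥0 in atTop, 0 ≤ ∫ t, r j t ∂(ν.map fun t => k * t) := fun j => by
    obtain ⟨U, hU, -, Z, hZ, m, hm, hrj⟩ := hr j
    have htr := ((hT U hU.nonempty).2.2.2 Z hZ).1
    set δ := Set.infsep (U : Set (EuclideanSpace ℝ (Fin n))) / (2 * (m : ℝ)) with hδ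
    have hm' : (1 : ℝ) ≤ m := by exact_mod_cast hm
    have hsep : 0 < Set.infsep (U : Set (EuclideanSpace ℝ (Fin n))) :=
      U.finite_toSet.infsep_pos_iff_nontrivial.2 hU
    have hδ0 : 0 < δ := by positivity
    -- Balls around distinct points are disjoint, so in the limit only the diagonal entries of `Z`
    -- survive.
    have h2δ : 2 * δ ≤ Set.infsep (U : Set (EuclideanSpace ℝ (Fin n))) := by
      have : 2 * δ = Set.infsep (U : Set (EuclideanSpace ℝ (Fin n))) / m := by
        rw [hδ]
        field_simp
      rw [this]
      exact div_le_self hsep.le hm'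
    have hlim : Tendsto (fun k : ℝ≥0 => ∑ x : U, ∑ y : U, Z x y * ((k : ℝ) ^ n *
        ∫ x' in Metric.ball (x : EuclideanSpace ℝ (Fin n)) δ,
          ∫ y' in Metric.ball (y : EuclideanSpace ℝ (Fin n)) δ, G ((k : ℝ) * ‖x' - y'‖))) atTop
        (𝓝 (∑ x : U, ∑ y : U, Z x y * (volume.real (Metric.ball (x : EuclideanSpace ℝ (Fin n)) δ) *
          if (x : EuclideanSpace ℝ (Fin n)) = y
            then ∫ v : EuclideanSpace ℝ (Fin n), G ‖v‖ else 0))) :=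
      tendsto_finsetSum _ fun x _ => tendsto_finsetSum _ fun y _ =>
        (tendsto_pow_mul_integral_ball_ball hG hG0 hGR fun hxy => h2δ.trans
          (Set.infsep_le_dist_of_mem x.2 y.2 hxy)).const_mul _
    have hpos : 0 < ∑ x : U, ∑ y : U, Z x y *
        (volume.real (Metric.ball (x : EuclideanSpace ℝ (Fin n)) δ) *
          if (x : EuclideanSpace ℝ (Fin n)) = y
            then ∫ v : EuclideanSpace ℝ (Fin n), G ‖v‖ else 0) := by
      have hvol : ∀ x : EuclideanSpace ℝ (Fin n), volume.real (Metric.ball x δ) =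
          volume.real (Metric.ball (0 : EuclideanSpace ℝ (Fin n)) δ) :=
        fun x => by simp only [measureReal_def, Measure.addHaar_ball_center]
      have hvol0 : 0 < volume.real (Metric.ball (0 : EuclideanSpace ℝ (Fin n)) δ) :=
        ENNReal.toReal_pos (Metric.measure_ball_pos _ _ hδ0).ne' measure_ball_lt_top.ne
      simp only [hvol, SetCoe.ext_iff, mul_ite, mul_zero, Finset.sum_ite_eq, Finset.mem_univ,
        if_true, ← Finset.sum_mul]
      exact mul_pos htr (mul_pos hvol0 hw)
    filter_upwards [hlim.eventually_const_lt hpos, eventually_gt_atTop 0] with k hk hk0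
    rw [hrj, integral_thickFun hn]
    simp only [hmap]
    refine (pos_of_mul_pos_right (a := (k : ℝ) ^ n) (lt_of_lt_of_eq hk ?_) (by positivity)).le
    rw [Finset.mul_sum]
    refine Finset.sum_congr rfl fun x _ => ?_
    rw [Finset.mul_sum]
    exact Finset.sum_congr rfl fun y _ => mul_left_comm _ _ _
  have hev' : ∀ᶠ k : ℝ≥0 in atTop, ∀ j ∈ Finset.range N, 0 ≤ ∫ t, r j t ∂(ν.map fun t => k * t) :=
    (Finset.range N).eventually_all.2 fun j _ => hev j
  obtain ⟨k, hk, hkR⟩ := (hev'.and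
    ((NNReal.tendsto_coe_atTop.2 tendsto_id).eventually_ge_atTop R)).exists
  refine ⟨ν.map fun t => k * t, (hprob k).measure_univ, ?_, fun j hj => hk j (Finset.mem_range.2 hj)⟩
  -- The `Ω_n`-constraint is the value `G (k * 1)`, zero since `k ≥ R`.
  have := hmap k 1
  simp only [mul_one] at this
  rw [this]
  exact hGR _ hkR

/-- Both optimal values exist as finite real numbers and agree: `ϑ_N` is the supremum of the
primal objective values and the infimum of the dual ones. -/
theorem mainTheorem8 (n : ℕ) (hn : 2 ≤ n)
    (T : (U : Finset (EuclideanSpace ℝ (Fin n))) → Set (Matrix U U ℝ)) (hT : IsTipSelection T)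
    (r : ℕ → ℝ≥0 → ℝ) (hr : Set.range r = thickFunctions T) (N : ℕ) :
    IsLUB (primalValues n r N) (theta n r N) ∧ IsGLB (dualValues n r N) (theta n r N) := by
  have hn1 : 1 ≤ n := by omega
  have hr' : ∀ k, r k ∈ thickFunctions T := fun k => hr ▸ Set.mem_range_self k
  obtain ⟨β, hβ, hβΩ, hβr⟩ := exists_primalFeasible hn1 hT hr' N
  have hΩ : Continuous fun t : ℝ≥0 => Omega n (t : ℝ) :=
    (continuous_Omega hn1).comp NNReal.continuous_coe
  have hΩ0 : Tendsto (fun t : ℝ≥0 => Omega n (t : ℝ)) (cocompact ℝ≥0) (𝓝 0) := by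
    rw [cocompact_eq_atTop]
    simpa using tendsto_Omega_mul_atTop hn one_pos
  have hrc : ∀ k, Continuous (r k) := fun k => by
    obtain ⟨U, -, -, Z, -, m, -, h⟩ := hr' k
    exact h ▸ continuous_thickFun hn1 U Z _
  have hr0 : ∀ k, Tendsto (r k) (cocompact ℝ≥0) (𝓝 0) := fun k => by
    obtain ⟨U, -, -, Z, -, m, -, h⟩ := hr' k
    rw [cocompact_eq_atTop]
    exact h ▸ tendsto_thickFun_atTop hn U Z _
  have hprob : ∀ α ∈ primalFeasible n r N, IsProbabilityMeasure α := fun α hα => ⟨hα.1⟩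
  have hlub : IsLUB (primalValues n r N) (theta n r N) := by
    refine isLUB_csSup ⟨_, β, ⟨hβ, hβΩ, hβr⟩, rfl⟩ ⟨1, ?_⟩
    rintro _ ⟨α, hα, rfl⟩
    have := hprob α hα
    exact measureReal_le_one
  refine ⟨hlub, ?_, ?_⟩
  · rintro l ⟨z, y, h0, hpos, hy⟩
    refine hlub.2 ?_
    rintro _ ⟨α, hα, rfl⟩
    have := hprob α hα
    have hαint : ∀ k : Fin N, Integrable (r k) α := fun k =>
      integrable_of_tendsto_cocompact (hrc k) (hr0 k) α
    have hαΩ := integrable_of_tendsto_cocompact hΩ hΩ0 α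
    have hαl : Integrable (fun t : ℝ≥0 => l + z * Omega n (t : ℝ)) α :=
      (integrable_const l).add (hαΩ.const_mul z)
    have hαsum : Integrable (fun t => ∑ k : Fin N, y k * r k t) α :=
      integrable_finsetSum _ fun k _ => (hαint k).const_mul _
    calc α.real {0} = ∫ t, Set.indicator {0} (fun _ => (1 : ℝ)) t ∂α := by
          rw [integral_indicator_const _ (measurableSet_singleton 0), smul_eq_mul, mul_one]
      _ ≤ ∫ t : ℝ≥0, (l + z * Omega n (t : ℝ)) + ∑ k : Fin N, y k * r k t ∂α := by
          refine integral_mono ((integrable_const 1).indicator (measurableSet_singleton 0))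
            (hαl.add hαsum) fun t => ?_
          rcases eq_or_ne t 0 with rfl | ht
          · simpa [Omega_zero hn1] using h0
          · simpa [ht] using hpos t (pos_iff_ne_zero.2 ht)
      _ = l + ∑ k : Fin N, y k * ∫ t, r k t ∂α := by
          rw [integral_add hαl hαsum,
            integral_add (integrable_const l) (hαΩ.const_mul z), integral_const_mul, hα.2.1,
            integral_finsetSum _ fun k _ => (hαint k).const_mul _]
          simp [integral_const_mul]
      _ ≤ l := by
          have : ∑ k : Fin N, y k * ∫ t, r k t ∂α ≤ 0 := Finset.sum_nonpos fun k _ =>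
            mul_nonpos_of_nonpos_of_nonneg (hy k) (hα.2.2 k k.2)
          linarith
  · intro b hb
    refine le_of_forall_gt_imp_ge_of_dense fun l hl => hb ?_
    obtain ⟨z, y, hy, h0, hpos⟩ := exists_dual_solution (ι := Fin N) (f := fun k => r k) hΩ
      (fun k => hrc k) hΩ0 (fun k => hr0 k) 0 (l := l) fun α hα hαΩ hαr => by
        have hαfin : IsFiniteMeasure α := ⟨hα.trans_lt ENNReal.one_lt_top⟩
        have hβfin : IsFiniteMeasure β := ⟨hβ.trans_lt ENNReal.one_lt_top⟩
        -- The missing mass. Adding `m • β` restores total mass `1`, keeps the constraints and can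
        -- only increase the mass at `0`.
        set m := 1 - α Set.univ with hm
        have hmtop : m ≠ ⊤ := ENNReal.sub_ne_top ENNReal.one_ne_top
        have hadd : ∀ h : ℝ≥0 → ℝ, Continuous h → Tendsto h (cocompact ℝ≥0) (𝓝 0) →
            ∫ t, h t ∂(α + m • β) = ∫ t, h t ∂α + m.toReal * ∫ t, h t ∂β := fun h hc h0 => by
          rw [integral_add_measure (integrable_of_tendsto_cocompact hc h0 α)
            ((integrable_of_tendsto_cocompact hc h0 β).smul_measure hmtop), integral_smul_measure, smul_eq_mul]
        have hfeas : α + m • β ∈ primalFeasible n r N := by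
          refine ⟨?_, ?_, fun k hk => ?_⟩
          · simp [hβ, hm, add_tsub_cancel_of_le hα]
          · rw [hadd _ hΩ hΩ0, hαΩ, hβΩ, mul_zero, add_zero]
          · rw [hadd _ (hrc k) (hr0 k)]
            exact add_nonneg (hαr ⟨k, hk⟩) (mul_nonneg ENNReal.toReal_nonneg (hβr k hk))
        have := hprob _ hfeas
        refine lt_of_le_of_lt ?_ hl
        refine le_trans ?_ (hlub.1 ⟨_, hfeas, rfl⟩)
        exact ENNReal.toReal_mono (measure_ne_top _ _) (by simp)
    refine ⟨z, y, ?_, fun t _ => hpos t, hy⟩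
    simpa [Omega_zero hn1] using h0
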